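/- Let $V$ be a finite-dimensional complex vector space. A \emph{real structure} on $V$ is a conjugate-linear map $r:V\to V$ with $r^2=1$. A \emph{Hodge structure of weight $1$} on $V$ consists of a real structure $r$ and a decomposition $V=V^{1,0}\oplus V^{0,1}$ into complex subspaces with $r(V^{1,0})=V^{0,1}$ (hence also $r(V^{0,1})=V^{1,0}$). A \emph{quaternionic structure} on $V$ is a conjugate-linear map $J:V\to V$ with $J^2=-1$. A \emph{complete filtration} of $V$ is a decreasing chain $V=\mathcal F^0\supseteq \mathcal F^1\supseteq\cdots$ of subspaces with $\mathcal F^N=0$ for some $N$. For complete filtrations $\mathcal F,\mathcal G$, the \emph{Rees–Simpson bundle} $\mathcal S(V,\mathcal F,\mathcal G)$ is the algebraic vector bundle on $\mathbb P^1$ whose restriction to $\mathbb C^*$ is $V\otimes\mathcal O_{\mathbb C^*}$, whose sections on $\mathbb P^1\setminus\{\infty\}$ are generated over $\mathbb C[z]$ by the $z^{-k}v$ with $v\in\mathcal F^k$, and whose sections on $\mathbb P^1\setminus\{0\}$ are generated over $\mathbb C[z^{-1}]$ by the $z^{k}v$ with $v\in\mathcal G^k$. (Two such bundles are regarded as equal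 if they are equal as subsheaves of the sheaf of rational sections of $V\otimes\mathcal O$; the zero bundle counts as semistable of every slope.) To a Hodge structure $H=(r,V^{1,0},V^{0,1})$ of weight $1$ attach the quaternionic structure $J_H(v,w)=(-r(w),r(v))$ on $V=V^{1,0}\oplus V^{0,1}$, and the bundle $\mathcal S_H=\mathcal S(V,\mathcal F_H,r\mathcal F_H)$, where $\mathcal F_H$ is the Hodge filtration $V\supseteq V^{1,0}\supseteq 0$. Then: 1. The map $H\mapsto (V^{1,0},V^{0,1},J_H)$ is a bijection from the set of Hodge structures of weight $1$ on $V$ onto the set of triples $(V',V'',J)$ with $V=V'\oplus V''$, $J$ a quaternionic structure on $V$, $J(V')=V''$ and $J(V'')=V'$. Thus, for a given decomposition of $V$, Hodge structures correspond one-to-one to the quaternionic structures that exchange the two summands. Moreover, every quaternionic structure on $V$ is $J_H$ for some Hodge structure $H$ of weight $1$. 2. The map $H\mapsto (r,\mathcal S_H)$ is a bijection from the set of Hodge structures of weight $1$ on $V$ onto the set of pairs $(r,\mathcal E)$, where $r$ is a real structure on $V$ and $\mathcal E=\mathcal S(V,\mathcal F,r\mathcal F)$, for some complete filtration $\mathcal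 F$ of $V$, is semistable of slope $1$. Thus, for a given real structure, Hodge structures of weight $1$ correspond one-to-one to the Rees–Simpson bundles of pairs of conjugate filtrations that are semistable of slope $1$. 3. For Hodge structures $H,H'$ of weight $1$ on $V$, the following are equivalent: $H\cong H'$; $J_H\cong J_{H'}$; $\mathcal S_H\cong\mathcal S_{H'}$ as vector bundles on $\mathbb P^1$. (Isomorphisms of Hodge structures and of quaternionic structures on $V$ are complex-linear automorphisms of $V$ that carry one structure to the other.) Consequently, the isomorphism classes of Hodge structures of weight $1$ on $V$, of quaternionic structures on $V$, and of semistable bundles of slope $1$ as in 2 correspond one-to-one. -/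

import Mathlib

open scoped LaurentPolynomial TensorProduct

noncomputable section

/-- A real structure on a complex vector space: a conjugate-linear involution. -/
@[ext] structure RealStructure (V : Type*) [AddCommGroup V] [Module ℂ V] where
  conj : V →ₛₗ[starRingEnd ℂ] V
  conj_conj : ∀ v, conj (conj v) = v

/-- A quaternionic structure on a complex vector space: a conjugate-linear (hence real-linear)
endomorphism `J` with `J ^ 2 = -1`. -/
@[ext] structure QuaternionicStructure (V : Type*) [AddCommGroup V] [Module ℂ V] where
  J : V →ₛₗ[starRingEnd ℂ] V
  J_J : ∀ v, J (J v) = -v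

/-- A (real) Hodge structure of weight `p` on `V`: a real structure, together with a decomposition
`V = ⨁_{r + s = p} V^{r,s}` such that `V^{s,r}` is the conjugate of `V^{r,s}`.
The summand `V^{r,p-r}` is `piece r`; note that `Fin.rev r = p - r`. -/
@[ext] structure HodgeStructure (p : ℕ) (V : Type*) [AddCommGroup V] [Module ℂ V] where
  real : RealStructure V
  piece : Fin (p + 1) → Submodule ℂ V
  isInternal : DirectSum.IsInternal piece
  map_conj : ∀ r, (piece r).map real.conj = piece r.rev

/-- A complete decreasing filtration `V = F⁰ ⊇ F¹ ⊇ ⋯ ⊇ F^N = 0`. -/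
@[ext] structure CompleteFiltration (V : Type*) [AddCommGroup V] [Module ℂ V] where
  F : ℕ → Submodule ℂ V
  anti : Antitone F
  zero_eq_top : F 0 = ⊤
  exists_eq_bot : ∃ N, F N = ⊥

section Vec

variable {V : Type*} [AddCommGroup V] [Module ℂ V]

/-- The conjugate filtration. -/
def CompleteFiltration.conjBy (F : CompleteFiltration V) (c : RealStructure V) :
    CompleteFiltration V where
  F k := (F.F k).map c.conj
  anti := fun _ _ h => Submodule.map_mono (F.anti h)
  zero_eq_top := by
    rw [F.zero_eq_top, eq_top_iff]
    intro v _
    exact ⟨c.conj v, trivial, c.conj_conj v⟩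
  exists_eq_bot := by
    obtain ⟨N, hN⟩ := F.exists_eq_bot
    exact ⟨N, by rw [hN, Submodule.map_bot]⟩

/-- The Hodge filtration `F^k = ⨁_{i ≥ k} V^{i,p-i}`. -/
def HodgeStructure.filtration {p : ℕ} (H : HodgeStructure p V) : CompleteFiltration V where
  F k := ⨆ i : Fin (p + 1), ⨆ _ : k ≤ (i : ℕ), H.piece i
  anti := fun _ _ h => iSup_mono fun _ => iSup_mono' fun h' => ⟨h.trans h', le_rfl⟩
  zero_eq_top := by
    have h := H.isInternal.submodule_iSup_eq_top
    simpa using h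
  exists_eq_bot := ⟨p + 1, by
    refine iSup_eq_bot.2 fun i => iSup_eq_bot.2 fun h => ?_
    have := i.2
    omega⟩

/-- For a Hodge structure of weight one, `V^{1,0}` and `V^{0,1}` are complementary. -/
theorem HodgeStructure.isCompl (H : HodgeStructure 1 V) : IsCompl (H.piece 1) (H.piece 0) :=
  (DirectSum.isInternal_submodule_iff_isCompl H.piece (i := 1) (j := 0) (by decide)
    (by ext i; fin_cases i <;> simp)).1 H.isInternal

/-- The projection of `V = V^{1,0} ⊕ V^{0,1}` to `V^{1,0}`. -/
def HodgeStructure.proj10 (H : HodgeStructure 1 V) : V →ₗ[ℂ] V :=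
  (H.piece 1).projection (H.piece 0) H.isCompl

/-- The projection of `V = V^{1,0} ⊕ V^{0,1}` to `V^{0,1}`. -/
def HodgeStructure.proj01 (H : HodgeStructure 1 V) : V →ₗ[ℂ] V :=
  (H.piece 0).projection (H.piece 1) H.isCompl.symm

/-- The endomorphism `J (v, w) = (-r w, r v)` of `V = V^{1,0} ⊕ V^{0,1}`, where `r` is the real
structure. -/
def HodgeStructure.toJ (H : HodgeStructure 1 V) : V →ₛₗ[starRingEnd ℂ] V :=
  H.real.conj.comp (H.proj10 - H.proj01)

theorem HodgeStructure.toJ_add (H : HodgeStructure 1 V) {v w : V}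
    (hv : v ∈ H.piece 1) (hw : w ∈ H.piece 0) :
    H.toJ (v + w) = -H.real.conj w + H.real.conj v := by
  have h1 : H.proj10 v = v := Submodule.projection_apply_of_mem_left H.isCompl hv
  have h2 : H.proj10 w = 0 := Submodule.projection_apply_of_mem_right H.isCompl hw
  have h3 : H.proj01 v = 0 := Submodule.projection_apply_of_mem_right H.isCompl.symm hv
  have h4 : H.proj01 w = w := Submodule.projection_apply_of_mem_left H.isCompl.symm hw
  simp only [toJ, LinearMap.comp_apply, LinearMap.sub_apply, map_add, map_sub, h1, h2, h3, h4,
    map_zero]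
  abel

theorem HodgeStructure.conj_mem (H : HodgeStructure 1 V) :
    (∀ v ∈ H.piece 1, H.real.conj v ∈ H.piece 0) ∧
      ∀ v ∈ H.piece 0, H.real.conj v ∈ H.piece 1 := by
  constructor
  · intro v hv
    have h := H.map_conj 1
    have h' : H.real.conj v ∈ (H.piece 1).map H.real.conj := ⟨v, hv, rfl⟩
    rw [h] at h'
    exact h'
  · intro v hv
    have h := H.map_conj 0
    have h' : H.real.conj v ∈ (H.piece 0).map H.real.conj := ⟨v, hv, rfl⟩
    rw [h] at h'
    exact h'

/-- The quaternionic structure attached to a Hodge structure of weight one. -/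
def HodgeStructure.toQuaternionic (H : HodgeStructure 1 V) : QuaternionicStructure V where
  J := H.toJ
  J_J x := by
    have hx : x ∈ H.piece 1 ⊔ H.piece 0 := by rw [H.isCompl.sup_eq_top]; trivial
    obtain ⟨v, hv, w, hw, rfl⟩ := Submodule.mem_sup.1 hx
    have h1 := H.conj_mem.1 v hv
    have h0 := (H.piece 1).neg_mem (H.conj_mem.2 w hw)
    rw [H.toJ_add hv hw, H.toJ_add h0 h1, map_neg, H.real.conj_conj, H.real.conj_conj]
    abel

/-- Isomorphism of Hodge structures on `V`. -/
def HodgeStructure.IsIso {p : ℕ} (H H' : HodgeStructure p V) : Prop :=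
  ∃ g : V ≃ₗ[ℂ] V, (∀ v, g (H.real.conj v) = H'.real.conj (g v)) ∧
    ∀ r, (H.piece r).map (g : V →ₗ[ℂ] V) = H'.piece r

/-- Isomorphism of quaternionic structures on `V`. -/
def QuaternionicStructure.IsIso (Q Q' : QuaternionicStructure V) : Prop :=
  ∃ g : V ≃ₗ[ℂ] V, ∀ v, g (Q.J v) = Q'.J (g v)

end Vec

/-! ### Vector bundles on the projective line

The projective line is glued from two affine lines, with coordinates `z` and `z⁻¹`, along the
punctured line, whose ring of functions is `ℂ[T;T⁻¹]` (`T 1` is the coordinate `z`). -/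

/-- The functions `ℂ[z]` on the chart around `0`. -/
abbrev FunZero : Subalgebra ℂ ℂ[T;T⁻¹] := Algebra.adjoin ℂ {LaurentPolynomial.T 1}

/-- The functions `ℂ[z⁻¹]` on the chart around `∞`. -/
abbrev FunInf : Subalgebra ℂ ℂ[T;T⁻¹] := Algebra.adjoin ℂ {LaurentPolynomial.T (-1)}

/-- The sections over the punctured line of the trivial bundle with fibre `V`. -/
abbrev LaurentSections (V : Type*) [AddCommGroup V] [Module ℂ V] : Type _ :=
  ℂ[T;T⁻¹] ⊗[ℂ] V

/-- An algebraic vector bundle on the projective line, given together with an embedding of its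
restriction to the punctured line as a subsheaf of the trivial bundle with fibre `V`: its sections
over the two charts are finitely generated modules over `ℂ[z]` and `ℂ[z⁻¹]`, which generate the
same module of sections over the overlap. For finite-dimensional `V` these modules are free,
being finitely generated and torsion-free over principal ideal domains. -/
@[ext] structure P1Bundle (V : Type*) [AddCommGroup V] [Module ℂ V] where
  zero : Submodule FunZero (LaurentSections V)
  inf : Submodule FunInf (LaurentSections V)
  zero_fg : zero.FG
  inf_fg : inf.FG
  glue : Submodule.span ℂ[T;T⁻¹] (zero : Set (LaurentSections V)) =
    Submodule.span ℂ[T;T⁻¹] (inf : Set (LaurentSections V))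

section Bundle

variable {V : Type*} [AddCommGroup V] [Module ℂ V]

namespace P1Bundle

/-- The sections over the punctured line. -/
def overlap (E : P1Bundle V) : Submodule ℂ[T;T⁻¹] (LaurentSections V) :=
  Submodule.span ℂ[T;T⁻¹] (E.zero : Set (LaurentSections V))

/-- `E'` is a coherent subsheaf of `E`. -/
def IsSubsheaf (E' E : P1Bundle V) : Prop := E'.zero ≤ E.zero ∧ E'.inf ≤ E.inf

/-- Isomorphism of vector bundles on the projective line: an isomorphism over the punctured line
that identifies the sections over each of the two charts. -/
def IsIso (E E' : P1Bundle V) : Prop :=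
  ∃ φ : E.overlap ≃ₗ[ℂ[T;T⁻¹]] E'.overlap,
    (∀ x : E.overlap, (x : LaurentSections V) ∈ E.zero ↔ (φ x : LaurentSections V) ∈ E'.zero) ∧
    ∀ x : E.overlap, (x : LaurentSections V) ∈ E.inf ↔ (φ x : LaurentSections V) ∈ E'.inf

/-- `E` has rank `n` and degree `d`: it has frames of `n` sections over the two charts, and the
determinant of the transition matrix between them is a nonzero constant times `z ^ d`. The sign is
the one for which `𝒪(k·0 + m·∞)`, generated by `z⁻ᵏ` around `0` and by `zᵐ` around `∞`, has
degree `k + m`. -/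
def HasRankDegree (E : P1Bundle V) (n : ℕ) (d : ℤ) : Prop :=
  ∃ (b₀ : Module.Basis (Fin n) FunZero E.zero) (b₁ : Module.Basis (Fin n) FunInf E.inf)
    (P : Matrix (Fin n) (Fin n) ℂ[T;T⁻¹]) (c : ℂ),
    c ≠ 0 ∧
    (∀ j, (b₁ j : LaurentSections V) = ∑ i, P i j • (b₀ i : LaurentSections V)) ∧
    P.det = LaurentPolynomial.C c * LaurentPolynomial.T d

/-- `E` is semistable of slope `μ`: its slope (degree divided by rank) is `μ`, and every nonzero
coherent subsheaf has slope at most `μ`. The zero bundle counts as semistable of every slope. -/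
def IsSemistable (E : P1Bundle V) (μ : ℚ) : Prop :=
  (∃ (n : ℕ) (d : ℤ), E.HasRankDegree n d ∧ (d : ℚ) = μ * n) ∧
  ∀ (E' : P1Bundle V), E'.IsSubsheaf E →
    ∀ (n : ℕ) (d : ℤ), n ≠ 0 → E'.HasRankDegree n d → (d : ℚ) / n ≤ μ

end P1Bundle

/-- The Rees module around `0`: generated over `ℂ[z]` by the sections `z⁻ᵏ v` with `v ∈ Fᵏ`. -/
def reesZero (F : CompleteFiltration V) : Submodule FunZero (LaurentSections V) :=
  Submodule.span FunZero
    {x | ∃ (k : ℕ) (v : V), v ∈ F.F k ∧ x = LaurentPolynomial.T (-(k : ℤ)) ⊗ₜ[ℂ] v}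

/-- The Rees module around `∞`, where the coordinate is `z⁻¹`: generated over `ℂ[z⁻¹]` by the
sections `zᵏ v` with `v ∈ Gᵏ`. -/
def reesInf (G : CompleteFiltration V) : Submodule FunInf (LaurentSections V) :=
  Submodule.span FunInf
    {x | ∃ (k : ℕ) (v : V), v ∈ G.F k ∧ x = LaurentPolynomial.T (k : ℤ) ⊗ₜ[ℂ] v}

theorem span_rees_eq_top (s : Set (LaurentSections V))
    (h : ∀ v : V, (1 : ℂ[T;T⁻¹]) ⊗ₜ[ℂ] v ∈ s) :
    Submodule.span ℂ[T;T⁻¹] s = ⊤ := by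
  rw [eq_top_iff]
  intro x _
  induction x using TensorProduct.induction_on with
  | zero => exact Submodule.zero_mem _
  | tmul a v =>
    have : a ⊗ₜ[ℂ] v = a • ((1 : ℂ[T;T⁻¹]) ⊗ₜ[ℂ] v) := by
      rw [TensorProduct.smul_tmul', smul_eq_mul, mul_one]
    rw [this]
    exact Submodule.smul_mem _ _ (Submodule.subset_span (h v))
  | add x y hx hy => exact Submodule.add_mem _ (hx trivial) (hy trivial)

/-- A submodule generated by sections `zᵉ v` with bounded pole order is finitely generated. -/
theorem fg_of_bounded [FiniteDimensional ℂ V] (t : ℂ[T;T⁻¹]) (S : Subalgebra ℂ ℂ[T;T⁻¹])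
    (hS : IsNoetherianRing S) (s : Set (LaurentSections V))
    (h : ∀ x ∈ s, ∃ (a : ℂ[T;T⁻¹]) (v : V), a ∈ S ∧ x = (a * t) ⊗ₜ[ℂ] v) :
    (Submodule.span S s).FG := by
  obtain ⟨B, hB⟩ := (Module.Finite.fg_top : (⊤ : Submodule ℂ V).FG)
  classical
  refine Submodule.FG.of_le (T := Submodule.span S
    ((B.image fun v => t ⊗ₜ[ℂ] v : Finset (LaurentSections V)) : Set (LaurentSections V)))
    ⟨_, rfl⟩ ?_
  rw [Submodule.span_le]
  intro x hx
  obtain ⟨a, v, ha, rfl⟩ := h x hx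
  clear hx
  have hv : v ∈ Submodule.span ℂ (B : Set V) := by rw [hB]; trivial
  have key : t ⊗ₜ[ℂ] v ∈ Submodule.span S
      ((B.image fun v => t ⊗ₜ[ℂ] v : Finset (LaurentSections V)) : Set (LaurentSections V)) := by
    induction hv using Submodule.span_induction with
    | mem y hy => exact Submodule.subset_span (by simpa using ⟨y, hy, rfl⟩)
    | zero => rw [TensorProduct.tmul_zero]; exact Submodule.zero_mem _
    | add y w _ _ h1 h2 => rw [TensorProduct.tmul_add]; exact Submodule.add_mem _ h1 h2
    | smul c y _ h1 =>
      have := Submodule.smul_mem _ (algebraMap ℂ S c) h1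
      rw [TensorProduct.tmul_smul]
      rwa [algebraMap_smul] at this
  have := Submodule.smul_mem _ (⟨a, ha⟩ : S) key
  have e : (⟨a, ha⟩ : S) • (t ⊗ₜ[ℂ] v : LaurentSections V) = (a * t) ⊗ₜ[ℂ] v := by
    rw [Subalgebra.smul_def, TensorProduct.smul_tmul', smul_eq_mul]
  rwa [e] at this

theorem isNoetherianRing_adjoin (t : ℂ[T;T⁻¹]) :
    IsNoetherianRing (Algebra.adjoin ℂ {t} : Subalgebra ℂ ℂ[T;T⁻¹]) := by
  have h : (Algebra.adjoin ℂ {t} : Subalgebra ℂ ℂ[T;T⁻¹]).FG := ⟨{t}, by simp⟩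
  have : Algebra.FiniteType ℂ (Algebra.adjoin ℂ {t} : Subalgebra ℂ ℂ[T;T⁻¹]) :=
    (Subalgebra.fg_iff_finiteType _).1 h
  exact Algebra.FiniteType.isNoetherianRing ℂ _

theorem reesZero_fg [FiniteDimensional ℂ V] (F : CompleteFiltration V) : (reesZero F).FG := by
  obtain ⟨N, hN⟩ := F.exists_eq_bot
  refine fg_of_bounded (LaurentPolynomial.T (-(N : ℤ))) FunZero (isNoetherianRing_adjoin _) _ ?_
  rintro x ⟨k, v, hv, rfl⟩
  rcases le_total k N with h | h
  · refine ⟨LaurentPolynomial.T 1 ^ (N - k), v,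
      Subalgebra.pow_mem _ (Algebra.subset_adjoin (Set.mem_singleton _)) _, ?_⟩
    rw [LaurentPolynomial.T_pow, ← LaurentPolynomial.T_add]
    congr 2
    push_cast [h]
    ring
  · have : v = 0 := by
      have := F.anti h hv
      rwa [hN, Submodule.mem_bot] at this
    exact ⟨0, v, Subalgebra.zero_mem _, by simp [this]⟩

theorem reesInf_fg [FiniteDimensional ℂ V] (G : CompleteFiltration V) : (reesInf G).FG := by
  obtain ⟨N, hN⟩ := G.exists_eq_bot
  refine fg_of_bounded (LaurentPolynomial.T (N : ℤ)) FunInf (isNoetherianRing_adjoin _) _ ?_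
  rintro x ⟨k, v, hv, rfl⟩
  rcases le_total k N with h | h
  · refine ⟨LaurentPolynomial.T (-1) ^ (N - k), v,
      Subalgebra.pow_mem _ (Algebra.subset_adjoin (Set.mem_singleton _)) _, ?_⟩
    rw [LaurentPolynomial.T_pow, ← LaurentPolynomial.T_add]
    congr 2
    push_cast [h]
    ring
  · have : v = 0 := by
      have := G.anti h hv
      rwa [hN, Submodule.mem_bot] at this
    exact ⟨0, v, Subalgebra.zero_mem _, by simp [this]⟩

/-- The Rees–Simpson bundle of a finite-dimensional vector space with two complete filtrations. -/
def reesSimpson [FiniteDimensional ℂ V] (F G : CompleteFiltration V) : P1Bundle V where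
  zero := reesZero F
  inf := reesInf G
  zero_fg := reesZero_fg F
  inf_fg := reesInf_fg G
  glue := by
    rw [span_rees_eq_top, span_rees_eq_top]
    · exact fun v => Submodule.subset_span ⟨0, v, by rw [G.zero_eq_top]; trivial, by simp⟩
    · exact fun v => Submodule.subset_span ⟨0, v, by rw [F.zero_eq_top]; trivial, by simp⟩

/-- The Rees–Simpson bundle of a Hodge structure: the one of the Hodge filtration and its
conjugate. -/
def HodgeStructure.toBundle [FiniteDimensional ℂ V] {p : ℕ} (H : HodgeStructure p V) :
    P1Bundle V :=
  reesSimpson H.filtration (H.filtration.conjBy H.real)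

end Bundle

end

/-! On a decomposition `V = V^{1,0} ⊕ V^{0,1}` the real structure `r` and the quaternionic structure
`J` agree on the first summand and are opposite on the second, so each determines the other: this is
the first bijection (`toHodge`, `ext_of_toQuaternionic`). Every quaternionic structure exchanges the
summands of some decomposition `W ⊕ J W`, where `W` is maximal among the subspaces with `W ∩ J W =
0` (`exists_isCompl_map`).

For the bundles, a basis adapted to both filtrations splits the Rees–Simpson bundle into line
bundles; those of a Hodge structure all have degree `1`. A subsheaf of rank `n` of a split bundle
has degree at most that of the sum of some `n` summands, because some maximal minor of the inclusion
matrix is nonzero (`exists_degree_le`). Hence `S_H` is semistable of slope `1`. Conversely, a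
nonzero `v ∈ F^k ∩ G^l` generates a line subsheaf of degree `k + l`, so semistability forces `F^2 =
G^2 = 0` and `F^1 ∩ G^1 = 0`; a complement of `F^1 ⊕ G^1` would contribute summands of degree `0`,
so having slope `1` forces it to vanish (`isCompl_of_isSemistable`). The bundle determines the
filtration through the coefficients of its sections around `0` (`sectionCoeff_mem`).

Finally `V^{1,0}` has half the dimension of `V`, and a linear isomorphism between the `(1,0)` parts
extends by conjugation. So any two Hodge structures of weight one on `V` are isomorphic (`isIso`),
and only the transport of an isomorphism to `J` and to the bundles remains to be checked. -/

noncomputable section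

/-! ### Hodge structures of weight one and quaternionic structures -/

section Hodge

variable {V : Type*} [AddCommGroup V] [Module ℂ V]

namespace HodgeStructure

theorem exists_add_eq (H : HodgeStructure 1 V) (x : V) :
    ∃ v ∈ H.piece 1, ∃ w ∈ H.piece 0, v + w = x :=
  Submodule.mem_sup.1 (by rw [H.isCompl.sup_eq_top]; trivial)

theorem toJ_of_mem_piece_one (H : HodgeStructure 1 V) {v : V} (hv : v ∈ H.piece 1) :
    H.toJ v = H.real.conj v := by
  simpa using H.toJ_add hv (H.piece 0).zero_mem

theorem toJ_of_mem_piece_zero (H : HodgeStructure 1 V) {w : V} (hw : w ∈ H.piece 0) :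
    H.toJ w = -H.real.conj w := by
  simpa using H.toJ_add (H.piece 1).zero_mem hw

/-- On each summand `J` is `r` up to sign, and the sign does not affect the image of a subspace. -/
theorem map_toJ (H : HodgeStructure 1 V) (r : Fin 2) :
    (H.piece r).map H.toJ = H.piece r.rev := by
  rw [← H.map_conj r]
  ext x
  simp only [Submodule.mem_map]
  obtain rfl | rfl : r = 0 ∨ r = 1 := by omega
  · constructor
    · rintro ⟨v, hv, rfl⟩
      exact ⟨-v, neg_mem hv, by rw [H.toJ_of_mem_piece_zero hv, map_neg]⟩
    · rintro ⟨v, hv, rfl⟩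
      exact ⟨-v, neg_mem hv, by rw [H.toJ_of_mem_piece_zero (neg_mem hv), map_neg, neg_neg]⟩
  · constructor <;> rintro ⟨v, hv, rfl⟩ <;> exact ⟨v, hv, by rw [H.toJ_of_mem_piece_one hv]⟩

theorem ext_of_toQuaternionic {H H' : HodgeStructure 1 V} (hp : H.piece = H'.piece)
    (hQ : H.toQuaternionic = H'.toQuaternionic) : H = H' := by
  have hJ : ∀ v, H.toJ v = H'.toJ v := fun v =>
    congrArg (fun Q : QuaternionicStructure V => Q.J v) hQ
  refine HodgeStructure.ext (RealStructure.ext (LinearMap.ext fun x => ?_)) hp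
  obtain ⟨v, hv, w, hw, rfl⟩ := H.exists_add_eq x
  have h1 := hJ v
  have h0 := hJ w
  rw [H.toJ_of_mem_piece_one hv, H'.toJ_of_mem_piece_one (hp ▸ hv)] at h1
  rw [H.toJ_of_mem_piece_zero hw, H'.toJ_of_mem_piece_zero (hp ▸ hw)] at h0
  rw [map_add, map_add, h1, neg_injective h0]

end HodgeStructure

theorem isCompl_of_isInternal {A : Fin 2 → Submodule ℂ V} (hA : DirectSum.IsInternal A) :
    IsCompl (A 1) (A 0) :=
  (DirectSum.isInternal_submodule_iff_isCompl A (i := 1) (j := 0) (by decide)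
    (by ext i; fin_cases i <;> simp)).1 hA

theorem isInternal_of_isCompl {A : Fin 2 → Submodule ℂ V} (hA : IsCompl (A 1) (A 0)) :
    DirectSum.IsInternal A :=
  (DirectSum.isInternal_submodule_iff_isCompl A (i := 1) (j := 0) (by decide)
    (by ext i; fin_cases i <;> simp)).2 hA

namespace QuaternionicStructure

/-- The real structure `(v, w) ↦ (-J w, J v)` attached to a quaternionic structure which exchanges
the summands of a decomposition of `V`. -/
def toReal (Q : QuaternionicStructure V) (A : Fin 2 → Submodule ℂ V)
    (hA : DirectSum.IsInternal A) : V →ₛₗ[starRingEnd ℂ] V :=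
  Q.J.comp ((A 1).projection (A 0) (isCompl_of_isInternal hA) -
    (A 0).projection (A 1) (isCompl_of_isInternal hA).symm)

variable (Q : QuaternionicStructure V) {A : Fin 2 → Submodule ℂ V} (hA : DirectSum.IsInternal A)

theorem toReal_of_mem_one {v : V} (hv : v ∈ A 1) : Q.toReal A hA v = Q.J v := by
  have h := isCompl_of_isInternal hA
  simp [toReal, Submodule.projection_apply_of_mem_left h hv,
    Submodule.projection_apply_of_mem_right h.symm hv]

theorem toReal_of_mem_zero {w : V} (hw : w ∈ A 0) : Q.toReal A hA w = -Q.J w := by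
  have h := isCompl_of_isInternal hA
  simp [toReal, Submodule.projection_apply_of_mem_right h hw,
    Submodule.projection_apply_of_mem_left h.symm hw]

/-- The Hodge structure of weight one attached to a quaternionic structure which exchanges the
summands of a decomposition of `V`. -/
def toHodge (hJ : ∀ r, (A r).map Q.J = A r.rev) : HodgeStructure 1 V where
  real :=
    { conj := Q.toReal A hA
      conj_conj := fun x => by
        have hx : x ∈ A 1 ⊔ A 0 := by rw [(isCompl_of_isInternal hA).sup_eq_top]; trivial
        obtain ⟨v, hv, w, hw, rfl⟩ := Submodule.mem_sup.1 hx
        have h1 : Q.J v ∈ A 0 := (hJ 1).le ⟨v, hv, rfl⟩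
        have h0 : Q.J w ∈ A 1 := (hJ 0).le ⟨w, hw, rfl⟩
        rw [map_add, Q.toReal_of_mem_one hA hv, Q.toReal_of_mem_zero hA hw, map_add, map_neg,
          Q.toReal_of_mem_zero hA h1, Q.toReal_of_mem_one hA h0, Q.J_J, Q.J_J, neg_neg, neg_neg] }
  piece := A
  isInternal := hA
  map_conj r := by
    rw [← hJ r]
    ext x
    simp only [Submodule.mem_map]
    obtain rfl | rfl : r = 0 ∨ r = 1 := (by decide : ∀ r : Fin 2, r = 0 ∨ r = 1) r
    · constructor
      · rintro ⟨v, hv, rfl⟩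
        exact ⟨-v, neg_mem hv, by rw [Q.toReal_of_mem_zero hA hv, map_neg]⟩
      · rintro ⟨v, hv, rfl⟩
        exact ⟨-v, neg_mem hv, by rw [Q.toReal_of_mem_zero hA (neg_mem hv), map_neg, neg_neg]⟩
    · constructor <;> rintro ⟨v, hv, rfl⟩ <;> exact ⟨v, hv, by rw [Q.toReal_of_mem_one hA hv]⟩

theorem toQuaternionic_toHodge (hJ : ∀ r, (A r).map Q.J = A r.rev) :
    (Q.toHodge hA hJ).toQuaternionic = Q := by
  refine QuaternionicStructure.ext (LinearMap.ext fun x => ?_)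
  obtain ⟨v, hv, w, hw, rfl⟩ := (Q.toHodge hA hJ).exists_add_eq x
  change (Q.toHodge hA hJ).toJ _ = _
  rw [HodgeStructure.toJ_add _ hv hw, map_add]
  change -Q.toReal A hA w + Q.toReal A hA v = _
  rw [Q.toReal_of_mem_zero hA hw, Q.toReal_of_mem_one hA hv, neg_neg, add_comm]

/-- A vector outside of a `J`-stable subspace is linearly independent of its image under `J`,
modulo that subspace. -/
theorem eq_zero_of_smul_add_smul_mem {U : Submodule ℂ V} (hU : ∀ u ∈ U, Q.J u ∈ U) {x : V}
    (hx : x ∉ U) {a c : ℂ} (h : a • x + c • Q.J x ∈ U) : a = 0 ∧ c = 0 := by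
  -- For `y = a x + c J x`, the combination `ā y - c J y` eliminates `J x` and leaves `(|a|² + |c|²)
  -- x`.
  have h1 := U.sub_mem (U.smul_mem (starRingEnd ℂ a) h) (U.smul_mem c (hU _ h))
  have e : (starRingEnd ℂ a) • (a • x + c • Q.J x) - c • Q.J (a • x + c • Q.J x) =
      ((Complex.normSq a + Complex.normSq c : ℝ) : ℂ) • x := by
    rw [map_add, map_smulₛₗ, map_smulₛₗ, Q.J_J]
    push_cast
    rw [← Complex.mul_conj, ← Complex.mul_conj]
    module
  rw [e] at h1
  have h2 : Complex.normSq a + Complex.normSq c = 0 := by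
    by_contra hne
    exact hx ((U.smul_mem_iff (by exact_mod_cast hne)).1 h1)
  have ha := Complex.normSq_nonneg a
  have hc := Complex.normSq_nonneg c
  exact ⟨Complex.normSq_eq_zero.1 (by linarith), Complex.normSq_eq_zero.1 (by linarith)⟩

/-- Take `W` maximal with `W ∩ J W = 0`. Then `W + J W` is `J`-stable, and a vector `x` outside it
could be adjoined to `W`, contradicting maximality. -/
theorem exists_isCompl_map [FiniteDimensional ℂ V] :
    ∃ W : Submodule ℂ V, IsCompl W (W.map Q.J) := by
  obtain ⟨W, hW, hmax⟩ := WellFounded.has_min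
    (wellFounded_gt (α := Submodule ℂ V)) {W | Disjoint W (W.map Q.J)} ⟨⊥, disjoint_bot_left⟩
  refine ⟨W, hW, codisjoint_iff.2 (by_contra fun hne => ?_)⟩
  obtain ⟨x, hx⟩ : ∃ x, x ∉ W ⊔ W.map Q.J := by
    by_contra! hall
    exact hne (eq_top_iff.2 fun x _ => hall x)
  have hU : ∀ u ∈ W ⊔ W.map Q.J, Q.J u ∈ W ⊔ W.map Q.J := by
    intro u hu
    obtain ⟨w, hw, _, ⟨w', hw', rfl⟩, rfl⟩ := Submodule.mem_sup.1 hu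
    rw [map_add, Q.J_J]
    exact add_mem (Submodule.mem_sup_right ⟨w, hw, rfl⟩) (Submodule.mem_sup_left (neg_mem hw'))
  refine hmax (W ⊔ ℂ ∙ x) ?_ (left_lt_sup.2 fun hle => hx (Submodule.mem_sup_left
    (hle (Submodule.mem_span_singleton_self x))))
  refine Submodule.disjoint_def.2 ?_
  rintro y hy ⟨y', hy', rfl⟩
  obtain ⟨w, hw, _, hax, e⟩ := Submodule.mem_sup.1 hy
  obtain ⟨a, rfl⟩ := Submodule.mem_span_singleton.1 hax
  obtain ⟨w', hw', _, hbx, rfl⟩ := Submodule.mem_sup.1 hy'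
  obtain ⟨b, rfl⟩ := Submodule.mem_span_singleton.1 hbx
  rw [map_add, map_smulₛₗ] at e
  -- The common element is `w + a x = J (w' + b x) = J w' + b̄ J x`. Moving the terms in `x` and `J
  -- x` to one side puts `a x - b̄ J x` in `W + J W`, which forces `a = b = 0`.
  have hmem : a • x + (-starRingEnd ℂ b) • Q.J x ∈ W ⊔ W.map Q.J := by
    have : a • x + (-starRingEnd ℂ b) • Q.J x = Q.J w' - w := by
      rw [neg_smul, ← sub_eq_add_neg, sub_eq_sub_iff_add_eq_add, add_comm, e]
    rw [this]
    exact sub_mem (Submodule.mem_sup_right ⟨w', hw', rfl⟩) (Submodule.mem_sup_left hw)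
  obtain ⟨rfl, hb⟩ := Q.eq_zero_of_smul_add_smul_mem hU hx hmem
  rw [neg_eq_zero] at hb
  rw [hb, zero_smul, zero_smul, add_zero, add_zero] at e
  rw [map_add, map_smulₛₗ, hb, zero_smul, add_zero]
  exact Submodule.disjoint_def.1 hW _ (e ▸ hw) ⟨w', hw', rfl⟩

theorem exists_toQuaternionic_eq [FiniteDimensional ℂ V] :
    ∃ H : HodgeStructure 1 V, H.toQuaternionic = Q := by
  obtain ⟨W, hW⟩ := Q.exists_isCompl_map
  have hJ : ∀ r, ((![W.map Q.J, W] : Fin 2 → Submodule ℂ V) r).map Q.J =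
      (![W.map Q.J, W] : Fin 2 → Submodule ℂ V) r.rev := by
    intro r
    obtain rfl | rfl : r = 0 ∨ r = 1 := (by decide : ∀ r : Fin 2, r = 0 ∨ r = 1) r
    · change (W.map Q.J).map Q.J = W
      ext x
      constructor
      · rintro ⟨_, ⟨w, hw, rfl⟩, rfl⟩
        rw [Q.J_J]
        exact neg_mem hw
      · intro hx
        exact ⟨_, ⟨-x, neg_mem hx, rfl⟩, by rw [Q.J_J, neg_neg]⟩
    · rfl
  exact ⟨_, Q.toQuaternionic_toHodge (isInternal_of_isCompl hW) hJ⟩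

end QuaternionicStructure

/-! ### Uniqueness of the Hodge structure of weight one up to isomorphism -/

namespace HodgeStructure

theorem finrank_piece [FiniteDimensional ℂ V] (H : HodgeStructure 1 V) :
    2 * Module.finrank ℂ (H.piece 1) = Module.finrank ℂ V := by
  have h : Module.finrank ℂ (H.piece 1) = Module.finrank ℂ (H.piece 0) := by
    -- Conjugation is only semilinear, so the ranks are compared along the automorphism `starRingEnd
    -- ℂ` of the scalars.
    let j : H.piece 1 ≃+ H.piece 0 :=
      { toFun := fun v => ⟨H.real.conj v, H.conj_mem.1 _ v.2⟩
        invFun := fun v => ⟨H.real.conj v, H.conj_mem.2 _ v.2⟩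
        left_inv := fun v => Subtype.ext (H.real.conj_conj _)
        right_inv := fun v => Subtype.ext (H.real.conj_conj _)
        map_add' := fun v w => Subtype.ext (map_add _ _ _) }
    exact congrArg Cardinal.toNat (rank_eq_of_equiv_equiv (starRingEnd ℂ) j
      (starRingAut (R := ℂ)).bijective fun c v => Subtype.ext (map_smulₛₗ H.real.conj c (v : V)))
  have := Submodule.finrank_add_eq_of_isCompl H.isCompl
  omega

/-- The map that extends a map `H^{1,0} → H'^{1,0}` to one which commutes with the real
structures. -/
def extend (H H' : HodgeStructure 1 V) (φ : H.piece 1 →ₗ[ℂ] H'.piece 1) : V →ₗ[ℂ] V :=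
  LinearMap.ofIsCompl H.isCompl ((H'.piece 1).subtype ∘ₗ φ)
    (H'.real.conj.comp (((H'.piece 1).subtype ∘ₗ φ).comp
      ((H.real.conj.comp (H.piece 0).subtype).codRestrict (H.piece 1)
        fun w => H.conj_mem.2 _ w.2)))

variable (H H' : HodgeStructure 1 V) (φ : H.piece 1 →ₗ[ℂ] H'.piece 1)

theorem extend_of_mem_piece_one {v : V} (hv : v ∈ H.piece 1) :
    H.extend H' φ v = φ ⟨v, hv⟩ :=
  LinearMap.ofIsCompl_apply_left H.isCompl ⟨v, hv⟩

theorem extend_of_mem_piece_zero {w : V} (hw : w ∈ H.piece 0) :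
    H.extend H' φ w = H'.real.conj (φ ⟨H.real.conj w, H.conj_mem.2 w hw⟩) :=
  LinearMap.ofIsCompl_apply_right H.isCompl ⟨w, hw⟩

theorem extend_mem {r : Fin 2} {v : V} (hv : v ∈ H.piece r) : H.extend H' φ v ∈ H'.piece r := by
  obtain rfl | rfl : r = 0 ∨ r = 1 := by omega
  · rw [extend_of_mem_piece_zero _ _ _ hv]
    exact H'.conj_mem.1 _ (Subtype.prop _)
  · rw [extend_of_mem_piece_one _ _ _ hv]
    exact Subtype.prop _

theorem extend_extend (H H' : HodgeStructure 1 V) (φ : H.piece 1 ≃ₗ[ℂ] H'.piece 1) (x : V) :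
    H'.extend H φ.symm (H.extend H' φ x) = x := by
  obtain ⟨v, hv, w, hw, rfl⟩ := H.exists_add_eq x
  have h1 := H.extend_mem H' φ hv
  have h0 := H.extend_mem H' φ hw
  rw [map_add, map_add, extend_of_mem_piece_one _ _ _ h1, extend_of_mem_piece_zero _ _ _ h0]
  simp only [extend_of_mem_piece_one _ _ _ hv, extend_of_mem_piece_zero _ _ _ hw,
    RealStructure.conj_conj, LinearEquiv.coe_coe, Subtype.coe_eta, LinearEquiv.symm_apply_apply]

theorem extend_conj (x : V) :
    H.extend H' φ (H.real.conj x) = H'.real.conj (H.extend H' φ x) := by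
  obtain ⟨v, hv, w, hw, rfl⟩ := H.exists_add_eq x
  simp only [map_add, extend_of_mem_piece_one _ _ _ hv, extend_of_mem_piece_zero _ _ _ hw,
    extend_of_mem_piece_zero _ _ _ (H.conj_mem.1 v hv),
    extend_of_mem_piece_one _ _ _ (H.conj_mem.2 w hw), RealStructure.conj_conj]

/-- Any two Hodge structures of weight one on a finite-dimensional space are isomorphic. -/
theorem isIso [FiniteDimensional ℂ V] (H H' : HodgeStructure 1 V) : H.IsIso H' := by
  have hφ : Module.finrank ℂ (H.piece 1) = Module.finrank ℂ (H'.piece 1) := by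
    have := H.finrank_piece
    have := H'.finrank_piece
    omega
  let φ := LinearEquiv.ofFinrankEq _ _ hφ
  refine ⟨LinearEquiv.ofLinearMap (H.extend H' φ) (H'.extend H φ.symm)
    (LinearMap.ext fun x => H'.extend_extend H φ.symm x)
    (LinearMap.ext fun x => H.extend_extend H' φ x), H.extend_conj H' φ, fun r => ?_⟩
  apply le_antisymm
  · rintro _ ⟨v, hv, rfl⟩
    exact H.extend_mem H' φ hv
  · intro v hv
    exact ⟨_, H'.extend_mem H φ.symm hv, H'.extend_extend H φ.symm v⟩

variable {H H'}

theorem IsIso.toQuaternionic (h : H.IsIso H') : H.toQuaternionic.IsIso H'.toQuaternionic := by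
  obtain ⟨g, hg, hp⟩ := h
  refine ⟨g, fun x => ?_⟩
  obtain ⟨v, hv, w, hw, rfl⟩ := H.exists_add_eq x
  have h1 : g v ∈ H'.piece 1 := (hp 1).le ⟨v, hv, rfl⟩
  have h0 : g w ∈ H'.piece 0 := (hp 0).le ⟨w, hw, rfl⟩
  change g (H.toJ _) = H'.toJ _
  rw [H.toJ_add hv hw, map_add g v, H'.toJ_add h1 h0, map_add, map_neg, hg, hg]

end HodgeStructure

end Hodge

/-! ### Laurent polynomials and maximal minors -/

theorem mem_funZero_iff {x : ℂ[T;T⁻¹]} : x ∈ FunZero ↔ ∃ p, Polynomial.toLaurent p = x := by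
  have : Polynomial.aeval (LaurentPolynomial.T 1) = (Polynomial.toLaurentAlg (R := ℂ)) := by
    ext; simp
  rw [FunZero, Algebra.adjoin_singleton_eq_range_aeval, this]
  rfl

theorem mem_funInf_iff {x : ℂ[T;T⁻¹]} :
    x ∈ FunInf ↔ ∃ p, LaurentPolynomial.invert (Polynomial.toLaurent p) = x := by
  have : Polynomial.aeval (LaurentPolynomial.T (-1)) =
      (LaurentPolynomial.invert (R := ℂ) : ℂ[T;T⁻¹] →ₐ[ℂ] ℂ[T;T⁻¹]).comp
        Polynomial.toLaurentAlg := by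
    ext; simp
  rw [FunInf, Algebra.adjoin_singleton_eq_range_aeval, this]
  rfl

theorem Polynomial.coeff_toLaurent_natCast (p : Polynomial ℂ) (n : ℕ) :
    (Polynomial.toLaurent p).coeff (n : ℤ) = p.coeff n :=
  Finsupp.mapDomain_apply Nat.castEmbedding.injective _ n

theorem Polynomial.coeff_toLaurent_of_neg (p : Polynomial ℂ) {m : ℤ} (hm : m < 0) :
    (Polynomial.toLaurent p).coeff m = 0 :=
  Finsupp.mapDomain_of_notMem_range _ _ (by
    rintro ⟨k, rfl⟩
    exact absurd hm (by simp))

theorem LaurentPolynomial.prod_T {ι : Type*} (s : Finset ι) (m : ι → ℤ) :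
    ∏ i ∈ s, (LaurentPolynomial.T (m i) : ℂ[T;T⁻¹]) = LaurentPolynomial.T (∑ i ∈ s, m i) := by
  classical
  induction s using Finset.induction_on with
  | empty => simp
  | insert i s hi ih =>
    rw [Finset.prod_insert hi, Finset.sum_insert hi, ih, LaurentPolynomial.T_add]

/-- If `d > s`, then `c α z ^ (d - s) = β` is both a polynomial in `z` without constant term and a
polynomial in `z⁻¹`. So it is zero, contrary to `α ≠ 0`. -/
theorem le_of_funZero_mul_eq_funInf_mul {α β : ℂ[T;T⁻¹]} (hα : α ∈ FunZero) (hβ : β ∈ FunInf)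
    (h0 : α ≠ 0) {c : ℂ} (hc : c ≠ 0) {d s : ℤ}
    (h : α * (LaurentPolynomial.C c * LaurentPolynomial.T d) = β * LaurentPolynomial.T s) :
    d ≤ s := by
  by_contra! hlt
  obtain ⟨p, rfl⟩ := mem_funZero_iff.1 hα
  obtain ⟨q, rfl⟩ := mem_funInf_iff.1 hβ
  obtain ⟨k, hk⟩ : ∃ k : ℕ, d = (k + 1 : ℕ) + s := ⟨(d - s - 1).toNat, by omega⟩
  have h1 : Polynomial.toLaurent (p * Polynomial.C c * Polynomial.X ^ (k + 1)) =
      LaurentPolynomial.invert (Polynomial.toLaurent q) := by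
    have hs := LaurentPolynomial.isUnit_T (R := ℂ) s
    refine hs.mul_left_injective ?_
    beta_reduce
    rw [← h, hk, LaurentPolynomial.T_add, map_mul, map_mul, Polynomial.toLaurent_C,
      Polynomial.toLaurent_X_pow]
    ring
  have h2 : p * Polynomial.C c * Polynomial.X ^ (k + 1) = 0 := by
    ext n
    rw [Polynomial.coeff_zero]
    rcases Nat.eq_zero_or_pos n with rfl | hn
    · simp
    · have h3 := congrArg (fun f : ℂ[T;T⁻¹] => f.coeff (n : ℤ)) h1
      simp only [LaurentPolynomial.invert_apply] at h3
      rwa [Polynomial.coeff_toLaurent_natCast,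
        Polynomial.coeff_toLaurent_of_neg _ (by omega : -(n : ℤ) < 0)] at h3
  replace h2 : p = 0 := by simpa [hc] using h2
  exact h0 (by rw [h2, map_zero])

/-- A matrix over a domain with linearly independent columns has a nonzero maximal minor. -/
theorem Matrix.exists_submatrix_det_ne_zero {R ι κ : Type*} [CommRing R] [IsDomain R] [Fintype ι]
    [Fintype κ] [DecidableEq κ] (A : Matrix ι κ R) (h : LinearIndependent R A.col) :
    ∃ f : κ → ι, Function.Injective f ∧ (A.submatrix f id).det ≠ 0 := by
  classical
  let K := FractionRing R
  let B : Matrix ι κ K := A.map (algebraMap R K)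
  have hB : LinearIndependent K B.col := by
    rw [← LinearIndependent.iff_fractionRing R K]
    refine h.map_injOn (((Algebra.linearMap R K).compLeft ι)) ?_
    refine Function.Injective.injOn fun x y hxy => ?_
    funext i
    exact IsFractionRing.injective R K (congrFun hxy i)
  -- Over the fraction field row rank equals column rank, so a basis of the row space chosen among
  -- the rows has exactly as many members as there are columns; these rows give the minor.
  have hrank : B.rank = Fintype.card κ := by
    rw [← Matrix.rank_transpose]
    exact LinearIndependent.rank_matrix hB
  obtain ⟨τ, a, ha, hspan, hli⟩ := exists_linearIndependent' K B.row
  have : Finite τ := Finite.of_injective a ha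
  have := Fintype.ofFinite τ
  have hcard : Fintype.card κ = Fintype.card τ := by
    rw [← hrank, Matrix.rank_eq_finrank_span_row, ← hspan, finrank_span_eq_card hli]
  let σ : κ ≃ τ := Fintype.equivOfCardEq hcard
  refine ⟨a ∘ σ, ha.comp σ.injective, fun hdet => ?_⟩
  have hu : IsUnit (B.submatrix (a ∘ σ) id) := by
    rw [← Matrix.linearIndependent_rows_iff_isUnit]
    exact hli.comp σ σ.injective
  rw [Matrix.isUnit_iff_isUnit_det] at hu
  refine hu.ne_zero ?_
  have := congrArg (algebraMap R K) hdet
  rwa [RingHom.map_det, map_zero] at this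

/-! ### Split bundles and the degrees of their subsheaves -/

section Bundle

variable {V : Type*} [AddCommGroup V] [Module ℂ V]

/-- The sections `z ^ a i ⊗ e i` of the trivial bundle with fibre `V` over the punctured line. -/
def laurentFrame {ι : Type*} (e : ι → V) (a : ι → ℤ) (i : ι) : LaurentSections V :=
  LaurentPolynomial.T (a i) ⊗ₜ[ℂ] e i

section Frame

variable {ι : Type*} {e : ι → V}

theorem laurentFrame_eq_smul (e : ι → V) (a b : ι → ℤ) (i : ι) :
    laurentFrame e b i = (LaurentPolynomial.T (b i - a i) : ℂ[T;T⁻¹]) • laurentFrame e a i := by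
  rw [laurentFrame, laurentFrame, TensorProduct.smul_tmul', smul_eq_mul, ← LaurentPolynomial.T_add,
    sub_add_cancel]

theorem linearIndependent_laurentFrame (he : LinearIndependent ℂ e) (a : ι → ℤ) :
    LinearIndependent ℂ[T;T⁻¹] (laurentFrame e a) := by
  have h := (Module.Flat.linearIndependent_one_tmul (S := ℂ[T;T⁻¹]) he).units_smul
    fun i => (LaurentPolynomial.isUnit_T (a i)).unit
  convert h using 1
  funext i
  change _ = (LaurentPolynomial.T (a i) : ℂ[T;T⁻¹]) • ((1 : ℂ[T;T⁻¹]) ⊗ₜ[ℂ] e i)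
  rw [TensorProduct.smul_tmul', smul_eq_mul, mul_one, laurentFrame]

theorem linearIndependent_subalgebra_laurentFrame (S : Subalgebra ℂ ℂ[T;T⁻¹])
    (he : LinearIndependent ℂ e) (a : ι → ℤ) :
    LinearIndependent S (laurentFrame e a) := by
  refine (linearIndependent_laurentFrame he a).restrict_scalars fun x y hxy => ?_
  simpa [Subalgebra.smul_def] using hxy

end Frame

namespace P1Bundle

/-- `E` is the direct sum of the line bundles generated by `z ^ a i ⊗ e i` around `0` and by
`z ^ b i ⊗ e i` around `∞`. -/
structure IsSplitBy {ι : Type*} (E : P1Bundle V) (e : ι → V) (a b : ι → ℤ) : Prop where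
  linearIndependent : LinearIndependent ℂ e
  zero_eq : E.zero = Submodule.span FunZero (Set.range (laurentFrame e a))
  inf_eq : E.inf = Submodule.span FunInf (Set.range (laurentFrame e b))

/-- The sum of the line bundles generated by `z ^ a i ⊗ e i` around `0` and by
`z ^ b i ⊗ e i` around `∞`. -/
def split {ι : Type*} [Finite ι] (e : ι → V) (a b : ι → ℤ) : P1Bundle V where
  zero := Submodule.span FunZero (Set.range (laurentFrame e a))
  inf := Submodule.span FunInf (Set.range (laurentFrame e b))
  zero_fg := Submodule.fg_span (Set.finite_range _)
  inf_fg := Submodule.fg_span (Set.finite_range _)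
  glue := by
    rw [Submodule.span_span_of_tower, Submodule.span_span_of_tower]
    apply le_antisymm <;> rw [Submodule.span_le] <;> rintro _ ⟨i, rfl⟩
    · rw [laurentFrame_eq_smul e b a]
      exact Submodule.smul_mem _ _ (Submodule.subset_span ⟨i, rfl⟩)
    · rw [laurentFrame_eq_smul e a b]
      exact Submodule.smul_mem _ _ (Submodule.subset_span ⟨i, rfl⟩)

theorem isSplitBy_split {ι : Type*} [Finite ι] {e : ι → V} (he : LinearIndependent ℂ e)
    (a b : ι → ℤ) : (split e a b).IsSplitBy e a b := ⟨he, rfl, rfl⟩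

namespace IsSplitBy

variable {ι : Type*} {E : P1Bundle V} {e : ι → V} {a b : ι → ℤ}

/-- The frame around `0` of a split bundle. -/
def basisZero (h : E.IsSplitBy e a b) : Module.Basis ι FunZero E.zero :=
  (Module.Basis.span (linearIndependent_subalgebra_laurentFrame FunZero h.linearIndependent a)).map
    (LinearEquiv.ofEq _ _ h.zero_eq.symm)

/-- The frame around `∞` of a split bundle. -/
def basisInf (h : E.IsSplitBy e a b) : Module.Basis ι FunInf E.inf :=
  (Module.Basis.span (linearIndependent_subalgebra_laurentFrame FunInf h.linearIndependent b)).map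
    (LinearEquiv.ofEq _ _ h.inf_eq.symm)

theorem coe_basisZero (h : E.IsSplitBy e a b) (i : ι) :
    (h.basisZero i : LaurentSections V) = laurentFrame e a i := by
  rw [basisZero, Module.Basis.map_apply]
  exact congrArg Subtype.val (Module.Basis.span_apply
    (linearIndependent_subalgebra_laurentFrame _ h.linearIndependent _) i)

theorem coe_basisInf (h : E.IsSplitBy e a b) (i : ι) :
    (h.basisInf i : LaurentSections V) = laurentFrame e b i := by
  rw [basisInf, Module.Basis.map_apply]
  exact congrArg Subtype.val (Module.Basis.span_apply
    (linearIndependent_subalgebra_laurentFrame _ h.linearIndependent _) i)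

theorem hasRankDegree [Fintype ι] (h : E.IsSplitBy e a b) :
    E.HasRankDegree (Fintype.card ι) (∑ i, (b i - a i)) := by
  let σ := Fintype.equivFin ι
  refine ⟨h.basisZero.reindex σ, h.basisInf.reindex σ,
    Matrix.diagonal fun i => LaurentPolynomial.T (b (σ.symm i) - a (σ.symm i)), 1, one_ne_zero,
    fun j => ?_, ?_⟩
  · rw [Finset.sum_eq_single j]
    · rw [Matrix.diagonal_apply_eq, Module.Basis.reindex_apply, Module.Basis.reindex_apply,
        coe_basisZero, coe_basisInf, ← laurentFrame_eq_smul]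
    · intro i _ hij
      rw [Matrix.diagonal_apply_ne _ hij, zero_smul]
    · simp
  · rw [Matrix.det_diagonal, map_one, one_mul,
      Equiv.prod_comp σ.symm fun i => (LaurentPolynomial.T (b i - a i) : ℂ[T;T⁻¹]),
      LaurentPolynomial.prod_T]

/-- The degree of a subsheaf of a split bundle is at most the degree of a sum of some of the
summands. -/
theorem exists_degree_le [Fintype ι] (h : E.IsSplitBy e a b) {E' : P1Bundle V}
    (hE : E'.IsSubsheaf E) {n : ℕ} {d : ℤ} (hd : E'.HasRankDegree n d) :
    ∃ f : Fin n → ι, Function.Injective f ∧ d ≤ ∑ j, (b (f j) - a (f j)) := by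
  obtain ⟨b₀, b₁, P, c, hc, hP, hdet⟩ := hd
  -- `A` and `B` are the matrices of the inclusion of the subsheaf around `0` and around `∞`.
  let A : Matrix ι (Fin n) FunZero := fun i j =>
    h.basisZero.repr (Submodule.inclusion hE.1 (b₀ j)) i
  let B : Matrix ι (Fin n) FunInf := fun i j =>
    h.basisInf.repr (Submodule.inclusion hE.2 (b₁ j)) i
  have hA : ∀ j, (b₀ j : LaurentSections V) =
      ∑ i, (A i j : ℂ[T;T⁻¹]) • laurentFrame e a i := by
    intro j
    have := congrArg (Subtype.val) (h.basisZero.sum_repr (Submodule.inclusion hE.1 (b₀ j)))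
    rw [Submodule.coe_inclusion] at this
    rw [← this, Submodule.coe_sum]
    refine Finset.sum_congr rfl fun i _ => ?_
    rw [Submodule.coe_smul, coe_basisZero, Subalgebra.smul_def]
  have hB : ∀ j, (b₁ j : LaurentSections V) =
      ∑ i, (B i j : ℂ[T;T⁻¹]) • laurentFrame e b i := by
    intro j
    have := congrArg (Subtype.val) (h.basisInf.sum_repr (Submodule.inclusion hE.2 (b₁ j)))
    rw [Submodule.coe_inclusion] at this
    rw [← this, Submodule.coe_sum]
    refine Finset.sum_congr rfl fun i _ => ?_
    rw [Submodule.coe_smul, coe_basisInf, Subalgebra.smul_def]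
  have hcol : LinearIndependent FunZero A.col := by
    have h1 : LinearIndependent FunZero fun j => Submodule.inclusion hE.1 (b₀ j) :=
      b₀.linearIndependent.map_injOn _ (Submodule.inclusion_injective hE.1).injOn
    exact h1.map_injOn (h.basisZero.equivFun : E.zero →ₗ[FunZero] ι → FunZero)
      h.basisZero.equivFun.injective.injOn
  -- Expanding `b₁ j` in the frame of `E` around `0` in two ways gives `A P = D B`, where `D` is the
  -- diagonal transition matrix of the split bundle.
  have hAP : ∀ i j, ∑ k, (A i k : ℂ[T;T⁻¹]) * P k j =
      (B i j : ℂ[T;T⁻¹]) * LaurentPolynomial.T (b i - a i) := by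
    intro i j
    have e1 : ∑ i, (∑ k, (A i k : ℂ[T;T⁻¹]) * P k j) • laurentFrame e a i =
        ∑ i, ((B i j : ℂ[T;T⁻¹]) * LaurentPolynomial.T (b i - a i)) • laurentFrame e a i := by
      have e2 : (b₁ j : LaurentSections V) =
          ∑ i, (∑ k, (A i k : ℂ[T;T⁻¹]) * P k j) • laurentFrame e a i := by
        rw [hP]
        simp_rw [hA, Finset.smul_sum, Finset.sum_smul, smul_smul]
        rw [Finset.sum_comm]
        simp_rw [mul_comm]
      rw [← e2, hB]
      refine Finset.sum_congr rfl fun i _ => ?_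
      rw [laurentFrame_eq_smul e a b, smul_smul]
    have e3 := Fintype.linearIndependent_iff.1
      (linearIndependent_laurentFrame h.linearIndependent a)
      (fun i => ∑ k, (A i k : ℂ[T;T⁻¹]) * P k j -
        (B i j : ℂ[T;T⁻¹]) * LaurentPolynomial.T (b i - a i))
      (by simp_rw [sub_smul]; rw [Finset.sum_sub_distrib, e1, sub_self]) i
    exact sub_eq_zero.1 e3
  -- Restricting `A P = D B` to the rows in `f` and taking determinants gives `det A_f · c z ^ d =
  -- det B_f · z ^ s`, with `s` the degree of the selected summands. Nonvanishing of `det A_f` then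
  -- bounds `d` by `s`.
  obtain ⟨f, hf, hdetA⟩ := A.exists_submatrix_det_ne_zero hcol
  refine ⟨f, hf, ?_⟩
  have hmat : (A.submatrix f id).map FunZero.val * P =
      Matrix.diagonal (fun j => LaurentPolynomial.T (b (f j) - a (f j))) *
        (B.submatrix f id).map FunInf.val := by
    ext1 i j
    rw [Matrix.mul_apply, Matrix.diagonal_mul, mul_comm (LaurentPolynomial.T _)]
    exact hAP (f i) j
  have hfin := congrArg Matrix.det hmat
  rw [Matrix.det_mul, Matrix.det_mul, Matrix.det_diagonal, LaurentPolynomial.prod_T, hdet,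
    mul_comm (LaurentPolynomial.T _)] at hfin
  have hα : ((A.submatrix f id).map FunZero.val).det =
      ((A.submatrix f id).det : ℂ[T;T⁻¹]) := (AlgHom.map_det FunZero.val _).symm
  have hβ : ((B.submatrix f id).map FunInf.val).det =
      ((B.submatrix f id).det : ℂ[T;T⁻¹]) := (AlgHom.map_det FunInf.val _).symm
  rw [hα, hβ] at hfin
  exact le_of_funZero_mul_eq_funInf_mul (Subtype.prop _) (Subtype.prop _)
    (fun h0 => hdetA (Subtype.ext h0)) hc hfin

end IsSplitBy

end P1Bundle

end Bundle

/-! ### Adapted bases and splittings of Rees–Simpson bundles -/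

section Rees

variable {V : Type*} [AddCommGroup V] [Module ℂ V]

namespace CompleteFiltration

/-- The basis `e` is adapted to the filtration `F`, the vector `e i` having weight `k i`. -/
def IsAdapted {ι : Type*} (F : CompleteFiltration V) (e : ι → V) (k : ι → ℕ) : Prop :=
  ∀ j, F.F j = Submodule.span ℂ (e '' {i | j ≤ k i})

/-- The basis depends only on the decomposition, the filtration only on the weights `κ`. Two
filtrations by sums of the same summands therefore share an adapted basis, which splits their
Rees–Simpson bundle. -/
theorem isAdapted_collectedBasis {σ : Type*} [DecidableEq σ] {A : σ → Submodule ℂ V}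
    (hA : DirectSum.IsInternal A) {α : σ → Type*} (v : ∀ s, Module.Basis (α s) ℂ (A s))
    {F : CompleteFiltration V} {κ : σ → ℕ} (hF : ∀ j, F.F j = ⨆ s, ⨆ _ : j ≤ κ s, A s) :
    F.IsAdapted (hA.collectedBasis v) fun x => κ x.1 := by
  intro j
  rw [hF]
  apply le_antisymm
  · refine iSup₂_le fun s hs => ?_
    have h := congrArg (Submodule.map (A s).subtype) (v s).span_eq
    rw [Submodule.map_span, Submodule.map_top, Submodule.range_subtype] at h
    rw [← h]
    refine Submodule.span_mono ?_
    rintro _ ⟨_, ⟨i, rfl⟩, rfl⟩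
    exact ⟨⟨s, i⟩, hs, by rw [hA.collectedBasis_coe]; rfl⟩
  · rw [Submodule.span_le]
    rintro _ ⟨x, hx, rfl⟩
    exact Submodule.mem_iSup_of_mem x.1 (Submodule.mem_iSup_of_mem hx
      (hA.collectedBasis_mem v x))

end CompleteFiltration

/-- The sign `ε` is `1` around `0` and `-1` around `∞`. A generator `z ^ (-ε j) e i` with `j ≤ k i`
is the multiple of `z ^ (-ε k i) e i` by the function `z ^ (ε (k i - j))`. -/
theorem span_rees_eq_span_laurentFrame {ι : Type*} {F : CompleteFiltration V} {e : ι → V}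
    {k : ι → ℕ} (h : F.IsAdapted e k) (ε : ℤ) (S : Subalgebra ℂ ℂ[T;T⁻¹])
    (hS : LaurentPolynomial.T ε ∈ S) :
    Submodule.span S {x : LaurentSections V | ∃ (j : ℕ) (v : V), v ∈ F.F j ∧
        x = LaurentPolynomial.T (-(ε * j)) ⊗ₜ[ℂ] v} =
      Submodule.span S (Set.range (laurentFrame e fun i => -(ε * k i))) := by
  apply le_antisymm <;> rw [Submodule.span_le]
  · rintro _ ⟨j, v, hv, rfl⟩
    rw [h j] at hv
    rw [SetLike.mem_coe]
    induction hv using Submodule.span_induction with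
    | zero => rw [TensorProduct.tmul_zero]; exact Submodule.zero_mem _
    | add y w _ _ h1 h2 => rw [TensorProduct.tmul_add]; exact Submodule.add_mem _ h1 h2
    | smul c y _ h1 =>
      have := Submodule.smul_mem _ (algebraMap ℂ S c) h1
      rw [TensorProduct.tmul_smul]
      rwa [algebraMap_smul] at this
    | mem y hy =>
      obtain ⟨i, hi, rfl⟩ := hy
      have hi : j ≤ k i := hi
      have := Submodule.smul_mem (Submodule.span S (Set.range (laurentFrame e fun i => -(ε * k i))))
        (⟨_, pow_mem hS (k i - j)⟩ : S) (Submodule.subset_span ⟨i, rfl⟩)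
      convert this using 1
      rw [Subalgebra.smul_def, laurentFrame, TensorProduct.smul_tmul', smul_eq_mul,
        show ((⟨_, pow_mem hS (k i - j)⟩ : S) : ℂ[T;T⁻¹]) =
          LaurentPolynomial.T ε ^ (k i - j) from rfl,
        LaurentPolynomial.T_pow,
        ← LaurentPolynomial.T_add]
      congr 2
      push_cast [hi]
      ring
  · rintro _ ⟨i, rfl⟩
    refine Submodule.subset_span ⟨k i, e i, ?_, rfl⟩
    rw [h]
    exact Submodule.subset_span ⟨i, le_refl (k i), rfl⟩

theorem reesZero_eq_span_laurentFrame {ι : Type*} {F : CompleteFiltration V} {e : ι → V}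
    {k : ι → ℕ} (h : F.IsAdapted e k) :
    reesZero F = Submodule.span FunZero (Set.range (laurentFrame e fun i => -(k i : ℤ))) := by
  simpa [reesZero] using span_rees_eq_span_laurentFrame h 1 FunZero
    (Algebra.subset_adjoin (Set.mem_singleton _))

theorem reesInf_eq_span_laurentFrame {ι : Type*} {G : CompleteFiltration V} {e : ι → V}
    {k : ι → ℕ} (h : G.IsAdapted e k) :
    reesInf G = Submodule.span FunInf (Set.range (laurentFrame e fun i => (k i : ℤ))) := by
  simpa [reesInf] using span_rees_eq_span_laurentFrame h (-1) FunInf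
    (Algebra.subset_adjoin (Set.mem_singleton _))

theorem baseChange_mem_span {S : Subalgebra ℂ ℂ[T;T⁻¹]} (g : V →ₗ[ℂ] V)
    {s t : Set (LaurentSections V)} (h : ∀ x ∈ s, g.baseChange ℂ[T;T⁻¹] x ∈ t)
    {x : LaurentSections V} (hx : x ∈ Submodule.span S s) :
    g.baseChange ℂ[T;T⁻¹] x ∈ Submodule.span S t := by
  induction hx using Submodule.span_induction with
  | mem y hy => exact Submodule.subset_span (h y hy)
  | zero => rw [map_zero]; exact Submodule.zero_mem _
  | add y w _ _ h1 h2 => rw [map_add]; exact Submodule.add_mem _ h1 h2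
  | smul c y _ h1 =>
    rw [Subalgebra.smul_def, map_smul, ← Subalgebra.smul_def]
    exact Submodule.smul_mem _ _ h1

namespace HodgeStructure

/-- Conjugation permutes the summands by `Fin.rev`, so the conjugate filtration uses the same
decomposition with reversed weights. -/
theorem conjBy_filtration_eq (H : HodgeStructure 1 V) (j : ℕ) :
    (H.filtration.conjBy H.real).F j = ⨆ s : Fin (1 + 1), ⨆ _ : j ≤ (s.rev : ℕ), H.piece s := by
  change (⨆ i : Fin (1 + 1), ⨆ _ : j ≤ (i : ℕ), H.piece i).map H.real.conj = _
  simp_rw [Submodule.map_iSup, H.map_conj]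
  exact Equiv.iSup_congr Fin.revPerm fun i => by simp

theorem filtration_one (H : HodgeStructure 1 V) : H.filtration.F 1 = H.piece 1 := by
  change (⨆ i : Fin (1 + 1), ⨆ _ : 1 ≤ (i : ℕ), H.piece i) = _
  apply le_antisymm
  · refine iSup₂_le fun i hi => ?_
    obtain rfl : i = 1 := Fin.ext (le_antisymm (Nat.le_of_lt_succ i.2) hi)
    exact le_rfl
  · exact le_iSup₂_of_le 1 le_rfl le_rfl

theorem filtration_of_one_lt (H : HodgeStructure 1 V) {j : ℕ} (hj : 1 < j) :
    H.filtration.F j = ⊥ := by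
  refine iSup_eq_bot.2 fun i => iSup_eq_bot.2 fun h => ?_
  have := i.2
  omega

end HodgeStructure

variable [FiniteDimensional ℂ V]

theorem isSplitBy_reesSimpson {ι : Type*} {F G : CompleteFiltration V} {e : ι → V}
    {k l : ι → ℕ} (he : LinearIndependent ℂ e) (hF : F.IsAdapted e k) (hG : G.IsAdapted e l) :
    (reesSimpson F G).IsSplitBy e (fun i => -(k i : ℤ)) fun i => l i :=
  ⟨he, reesZero_eq_span_laurentFrame hF, reesInf_eq_span_laurentFrame hG⟩

theorem overlap_reesSimpson (F G : CompleteFiltration V) : (reesSimpson F G).overlap = ⊤ :=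
  span_rees_eq_top _ fun v =>
    Submodule.subset_span ⟨0, v, by rw [F.zero_eq_top]; trivial, by simp⟩

theorem baseChange_mem_reesSimpson {F G F' G' : CompleteFiltration V} (g : V →ₗ[ℂ] V)
    (hF : ∀ k, (F.F k).map g ≤ F'.F k) (hG : ∀ k, (G.F k).map g ≤ G'.F k)
    (x : LaurentSections V) :
    (x ∈ (reesSimpson F G).zero → g.baseChange ℂ[T;T⁻¹] x ∈ (reesSimpson F' G').zero) ∧
    (x ∈ (reesSimpson F G).inf → g.baseChange ℂ[T;T⁻¹] x ∈ (reesSimpson F' G').inf) := by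
  constructor
  · refine baseChange_mem_span g ?_
    rintro _ ⟨k, v, hv, rfl⟩
    exact ⟨k, g v, hF k ⟨v, hv, rfl⟩, LinearMap.baseChange_tmul _ _ _⟩
  · refine baseChange_mem_span g ?_
    rintro _ ⟨k, v, hv, rfl⟩
    exact ⟨k, g v, hG k ⟨v, hv, rfl⟩, LinearMap.baseChange_tmul _ _ _⟩

theorem isIso_reesSimpson {F G F' G' : CompleteFiltration V} (g : V ≃ₗ[ℂ] V)
    (hF : ∀ k, (F.F k).map (g : V →ₗ[ℂ] V) = F'.F k)
    (hG : ∀ k, (G.F k).map (g : V →ₗ[ℂ] V) = G'.F k) :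
    (reesSimpson F G).IsIso (reesSimpson F' G') := by
  have hinv : ∀ {A B : Submodule ℂ V}, A.map (g : V →ₗ[ℂ] V) = B →
      B.map (g.symm : V →ₗ[ℂ] V) ≤ A := by
    rintro A _ rfl _ ⟨_, ⟨v, hv, rfl⟩, rfl⟩
    simpa using hv
  have h1 := baseChange_mem_reesSimpson (g : V →ₗ[ℂ] V) (fun k => (hF k).le) fun k => (hG k).le
  have h2 := baseChange_mem_reesSimpson (g.symm : V →ₗ[ℂ] V) (fun k => hinv (hF k))
    fun k => hinv (hG k)
  have hsymm : ∀ x : LaurentSections V,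
      (g.symm : V →ₗ[ℂ] V).baseChange ℂ[T;T⁻¹] ((g : V →ₗ[ℂ] V).baseChange ℂ[T;T⁻¹] x) = x := by
    intro x
    rw [← LinearMap.comp_apply, ← LinearMap.baseChange_comp]
    simp
  let Φ := LinearEquiv.baseChange ℂ ℂ[T;T⁻¹] V V g
  refine ⟨(LinearEquiv.ofEq _ _ (overlap_reesSimpson F G)).trans ((Submodule.topEquiv.trans
    (Φ.trans Submodule.topEquiv.symm)).trans
    (LinearEquiv.ofEq _ _ (overlap_reesSimpson F' G').symm)), fun x => ?_, fun x => ?_⟩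
  · exact ⟨(h1 x).1, fun hx => hsymm x ▸ (h2 _).1 hx⟩
  · exact ⟨(h1 x).2, fun hx => hsymm x ▸ (h2 _).2 hx⟩

/-- A vector in `F^k ∩ G^l` generates a line subbundle of degree `k + l`. -/
theorem add_le_one_of_isSemistable {F G : CompleteFiltration V}
    (h : (reesSimpson F G).IsSemistable 1) {v : V} (hv : v ≠ 0) {k l : ℕ} (hk : v ∈ F.F k)
    (hl : v ∈ G.F l) : k + l ≤ 1 := by
  have hE := P1Bundle.isSplitBy_split (LinearIndependent.of_subsingleton (R := ℂ)
    (v := fun _ : Unit => v) () hv) (fun _ => -(k : ℤ)) fun _ => (l : ℤ)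
  have := h.2 _ ⟨?_, ?_⟩ _ _ (by simp) hE.hasRankDegree
  · simp only [Finset.univ_unique, Finset.sum_singleton, Fintype.card_unique] at this
    push_cast at this
    have h' : (l : ℚ) + k ≤ 1 := by linarith
    have : l + k ≤ 1 := by exact_mod_cast h'
    omega
  · refine Submodule.span_mono ?_
    rintro _ ⟨_, rfl⟩
    exact ⟨k, v, hk, rfl⟩
  · refine Submodule.span_mono ?_
    rintro _ ⟨_, rfl⟩
    exact ⟨l, v, hl, rfl⟩

namespace HodgeStructure

/-- A basis vector in `piece s` contributes weight `s` at `0` and `1 - s` at `∞`, hence a line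
bundle of degree `1`. -/
theorem isSplitBy_toBundle (H : HodgeStructure 1 V) :
    H.toBundle.IsSplitBy
      (H.isInternal.collectedBasis fun s => Module.finBasis ℂ (H.piece s))
      (fun x => -((x.1 : ℕ) : ℤ)) fun x => ((x.1.rev : ℕ) : ℤ) :=
  isSplitBy_reesSimpson (Module.Basis.linearIndependent _)
    (CompleteFiltration.isAdapted_collectedBasis H.isInternal _ (κ := fun s => s) fun _ => rfl)
    (CompleteFiltration.isAdapted_collectedBasis H.isInternal _ (κ := fun s => (s.rev : ℕ))
      H.conjBy_filtration_eq)

theorem isSemistable_toBundle (H : HodgeStructure 1 V) : H.toBundle.IsSemistable 1 := by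
  have h := H.isSplitBy_toBundle
  have h1 : ∀ s : Fin (1 + 1), ((s.rev : ℕ) : ℤ) - -((s : ℕ) : ℤ) = 1 := by decide
  refine ⟨⟨_, _, h.hasRankDegree, ?_⟩, fun E' hE' n d hn hd => ?_⟩
  · simp_rw [h1]
    simp
  · obtain ⟨f, -, hf⟩ := h.exists_degree_le hE' hd
    simp_rw [h1] at hf
    rw [div_le_one (by positivity)]
    have : d ≤ n := by simpa using hf
    exact_mod_cast this

variable {H H' : HodgeStructure 1 V}

theorem IsIso.toBundle (h : H.IsIso H') : H.toBundle.IsIso H'.toBundle := by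
  obtain ⟨g, -, hp⟩ := h
  have hF : ∀ k, (H.filtration.F k).map (g : V →ₗ[ℂ] V) = H'.filtration.F k := by
    intro k
    change (⨆ i : Fin (1 + 1), ⨆ _ : k ≤ (i : ℕ), H.piece i).map (g : V →ₗ[ℂ] V) = _
    simp_rw [Submodule.map_iSup, hp]
    rfl
  refine isIso_reesSimpson g hF fun k => ?_
  rw [conjBy_filtration_eq, conjBy_filtration_eq]
  simp_rw [Submodule.map_iSup, hp]

end HodgeStructure

end Rees

/-! ### Recovering the Hodge structure from the bundle -/

section Recover

variable {V : Type*} [AddCommGroup V] [Module ℂ V]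

/-- The coefficient of `z ^ m` of a section over the punctured line. -/
def sectionCoeff (m : ℤ) : LaurentSections V →ₗ[ℂ] V :=
  TensorProduct.lift
    { toFun := fun f => f.coeff m • LinearMap.id
      map_add' := fun f g => by simp [add_smul]
      map_smul' := fun c f => by simp [mul_smul] }

theorem sectionCoeff_tmul (m : ℤ) (f : ℂ[T;T⁻¹]) (v : V) :
    sectionCoeff m (f ⊗ₜ[ℂ] v) = f.coeff m • v := rfl

theorem coeff_mul_T (f : ℂ[T;T⁻¹]) (m n : ℤ) :
    (f * LaurentPolynomial.T n).coeff m = f.coeff (m - n) := by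
  have := AddMonoidAlgebra.coeff_mul_single_apply f (1 : ℂ) n m
  rwa [mul_one, ← sub_eq_add_neg] at this

theorem coeff_eq_zero_of_mem_funZero {f : ℂ[T;T⁻¹]} (hf : f ∈ FunZero) {m : ℤ} (hm : m < 0) :
    f.coeff m = 0 := by
  obtain ⟨p, rfl⟩ := mem_funZero_iff.1 hf
  exact p.coeff_toLaurent_of_neg hm

/-- In `f z ^ (-j) v` with `f ∈ ℂ[z]` and `v ∈ F^j`, only exponents at least `-j` occur. So `z ^
(-k)` has a nonzero coefficient only if `k ≤ j`, and then `v ∈ F^j ⊆ F^k`. -/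
theorem sectionCoeff_mem (F : CompleteFiltration V) {x : LaurentSections V}
    (hx : x ∈ reesZero F) (k : ℕ) : sectionCoeff (-(k : ℤ)) x ∈ F.F k := by
  -- Multiplication by `z` shifts coefficients, so the claim at a fixed `k` is not stable under
  -- scalars; the induction is over sums of multiples of generators.
  induction hx using Submodule.closure_induction with
  | zero => rw [map_zero]; exact Submodule.zero_mem _
  | add y w _ _ h1 h2 => rw [map_add]; exact Submodule.add_mem _ h1 h2
  | smul_mem p y hy =>
    obtain ⟨j, v, hv, rfl⟩ := hy
    rw [Subalgebra.smul_def, TensorProduct.smul_tmul', smul_eq_mul, sectionCoeff_tmul, coeff_mul_T]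
    rcases le_or_gt k j with h | h
    · exact Submodule.smul_mem _ _ (F.anti h hv)
    · rw [coeff_eq_zero_of_mem_funZero p.2 (by omega), zero_smul]
      exact Submodule.zero_mem _

/-- A filtration is determined by its Rees module. -/
theorem mem_iff_tmul_mem_reesZero (F : CompleteFiltration V) (k : ℕ) (v : V) :
    v ∈ F.F k ↔ LaurentPolynomial.T (-(k : ℤ)) ⊗ₜ[ℂ] v ∈ reesZero F := by
  refine ⟨fun hv => Submodule.subset_span ⟨k, v, hv, rfl⟩, fun h => ?_⟩
  simpa [sectionCoeff_tmul] using sectionCoeff_mem F h k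

/-- The chart around `0` suffices: it determines `F^1 = V^{1,0}`, and `V^{0,1}` is its conjugate. -/
theorem HodgeStructure.ext_of_toBundle [FiniteDimensional ℂ V] {H H' : HodgeStructure 1 V}
    (hr : H.real = H'.real) (hE : H.toBundle = H'.toBundle) : H = H' := by
  have hz : reesZero H.filtration = reesZero H'.filtration := congrArg P1Bundle.zero hE
  have h1 : H.piece 1 = H'.piece 1 := by
    rw [← filtration_one, ← filtration_one]
    ext v
    rw [mem_iff_tmul_mem_reesZero, hz, ← mem_iff_tmul_mem_reesZero]
  have h0 : H.piece 0 = H'.piece 0 := by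
    have h := H.map_conj 1
    have h' := H'.map_conj 1
    rw [hr, h1, h'] at h
    exact h.symm
  exact HodgeStructure.ext hr (funext (Fin.forall_fin_two.2 ⟨h0, h1⟩))

end Recover

/-! ### Hodge structures from semistable bundles -/

section Surjectivity

variable {V : Type*} [AddCommGroup V] [Module ℂ V]

theorem isInternal_of_isCompl_sup {A : Fin 3 → Submodule ℂ V} (h : Disjoint (A 1) (A 2))
    (hA : IsCompl (A 0) (A 1 ⊔ A 2)) : DirectSum.IsInternal A := by
  refine (DirectSum.isInternal_submodule_iff_iSupIndep_and_iSup_eq_top A).2 ⟨?_, ?_⟩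
  · have h1 : Disjoint (A 1) (A 0 ⊔ A 2) := by
      rw [sup_comm]
      exact h.disjoint_sup_right_of_disjoint_sup_left hA.disjoint.symm
    have h2 : Disjoint (A 2) (A 0 ⊔ A 1) := by
      rw [sup_comm]
      exact h.symm.disjoint_sup_right_of_disjoint_sup_left (sup_comm (A 1) (A 2) ▸ hA.disjoint.symm)
    intro i
    fin_cases i
    · exact hA.disjoint.mono_right (iSup₂_le fun j hj => by
        fin_cases j
        · exact absurd rfl hj
        · exact le_sup_left
        · exact le_sup_right)
    · exact h1.mono_right (iSup₂_le fun j hj => by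
        fin_cases j
        · exact le_sup_left
        · exact absurd rfl hj
        · exact le_sup_right)
    · exact h2.mono_right (iSup₂_le fun j hj => by
        fin_cases j
        · exact le_sup_left
        · exact le_sup_right
        · exact absurd rfl hj)
  · rw [eq_top_iff, ← hA.sup_eq_top]
    exact sup_le (le_iSup A 0) (sup_le (le_iSup A 1) (le_iSup A 2))

/-- The values of a filtration `V ⊇ F¹ ⊇ 0`, in terms of a decomposition of `V` one of whose
summands is `F¹`. -/
theorem CompleteFiltration.eq_iSup {σ : Type*} [DecidableEq σ] {A : σ → Submodule ℂ V}
    (hA : ⨆ s, A s = ⊤) {F : CompleteFiltration V} (h2 : F.F 2 = ⊥) {t : σ} (ht : F.F 1 = A t)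
    (j : ℕ) : F.F j = ⨆ s, ⨆ _ : j ≤ if s = t then 1 else 0, A s := by
  match j with
  | 0 => simp [F.zero_eq_top, hA]
  | 1 =>
    rw [ht]
    apply le_antisymm
    · exact le_iSup₂_of_le t (by simp) le_rfl
    · refine iSup₂_le fun s hs => ?_
      split_ifs at hs with h
      · rw [h]
      · omega
  | j + 2 =>
    rw [show F.F (j + 2) = ⊥ from eq_bot_iff.2 (h2 ▸ F.anti (by omega : 2 ≤ j + 2))]
    refine (iSup_eq_bot.2 fun s => iSup_eq_bot.2 fun hs => ?_).symm
    split_ifs at hs <;> omega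

variable [FiniteDimensional ℂ V]

/-- A common nonzero vector of `F^1` and `G^1` would generate a line subsheaf of degree `2`. A
complement `W` of their sum splits off summands of degree `0`, while the others have degree `1`, so
slope `1` leaves no room for `W`. -/
theorem isCompl_of_isSemistable {F G : CompleteFiltration V}
    (h : (reesSimpson F G).IsSemistable 1) (hF : F.F 2 = ⊥) (hG : G.F 2 = ⊥) :
    IsCompl (F.F 1) (G.F 1) := by
  have hdisj : Disjoint (F.F 1) (G.F 1) := Submodule.disjoint_def.2 fun v hv hw => by
    by_contra hne
    have := add_le_one_of_isSemistable h hne hv hw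
    omega
  refine ⟨hdisj, codisjoint_iff.2 ?_⟩
  obtain ⟨W, hW⟩ := exists_isCompl (F.F 1 ⊔ G.F 1)
  let A : Fin 3 → Submodule ℂ V := ![W, F.F 1, G.F 1]
  have hA : DirectSum.IsInternal A := isInternal_of_isCompl_sup hdisj hW.symm
  have hs := isSplitBy_reesSimpson
    (hA.collectedBasis fun s => Module.finBasis ℂ (A s)).linearIndependent
    (CompleteFiltration.isAdapted_collectedBasis hA _ (κ := fun s => if s = 1 then 1 else 0)
      (CompleteFiltration.eq_iSup hA.submodule_iSup_eq_top hF rfl))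
    (CompleteFiltration.isAdapted_collectedBasis hA _ (κ := fun s => if s = 2 then 1 else 0)
      (CompleteFiltration.eq_iSup hA.submodule_iSup_eq_top hG rfl))
  obtain ⟨n, d, hnd, hd⟩ := h.1
  -- The degree `d` comes from unknown frames. Applying the subsheaf bound to the bundle as a
  -- subsheaf of itself compares `d` with the degree of the splitting, without using that the degree
  -- is independent of the frames.
  obtain ⟨f, hf, hle⟩ := hs.exists_degree_le ⟨le_rfl, le_rfl⟩ hnd
  have hd : d = n := by
    rw [one_mul] at hd
    exact_mod_cast hd
  have hcard : Fintype.card (Fin n) =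
      Fintype.card ((s : Fin 3) × Fin (Module.finrank ℂ (A s))) := by
    obtain ⟨b₀, -⟩ := hnd
    rw [← Module.finrank_eq_card_basis b₀, Module.finrank_eq_card_basis hs.basisZero]
  have hsurj := ((Fintype.bijective_iff_injective_and_card f).2 ⟨hf, hcard⟩).surjective
  have hW0 : Module.finrank ℂ W = 0 := by
    by_contra hne
    -- Since `f` is onto, a basis vector of `W` is among the selected summands. It has degree `0`
    -- and the others at most `1`, so the sum is less than `n = d`.
    obtain ⟨j, hj⟩ := hsurj ⟨0, ⟨0, Nat.pos_of_ne_zero hne⟩⟩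
    refine absurd hle (not_le.2 ?_)
    have hlt := Finset.sum_lt_sum (s := Finset.univ)
      (f := fun j => (((if (f j).1 = 2 then 1 else 0 : ℕ) : ℤ) -
        -((if (f j).1 = 1 then 1 else 0 : ℕ) : ℤ))) (g := fun _ => (1 : ℤ))
      (fun j _ => (by decide : ∀ s : Fin 3, (((if s = 2 then 1 else 0 : ℕ) : ℤ) -
        -((if s = 1 then 1 else 0 : ℕ) : ℤ)) ≤ 1) _)
      ⟨j, Finset.mem_univ j, by rw [hj]; simp⟩
    rw [hd]
    simpa using hlt
  rw [← hW.sup_eq_top, Submodule.finrank_eq_zero.1 hW0, sup_bot_eq]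

theorem exists_hodgeStructure_of_isSemistable (r : RealStructure V) (F : CompleteFiltration V)
    (h : (reesSimpson F (F.conjBy r)).IsSemistable 1) :
    ∃ H : HodgeStructure 1 V, H.real = r ∧ H.filtration = F := by
  -- The conjugate filtration is all of `V` in step `0`, so a nonzero `v ∈ F^2` would generate a
  -- line subsheaf of degree at least `2 + 0`.
  have h2 : F.F 2 = ⊥ := (Submodule.eq_bot_iff _).2 fun v hv => by
    by_contra hne
    have := add_le_one_of_isSemistable h hne hv
      (l := 0) (by rw [(F.conjBy r).zero_eq_top]; trivial)
    omega
  have hc : IsCompl (F.F 1) ((F.F 1).map r.conj) := isCompl_of_isSemistable h h2 (by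
    change (F.F 2).map r.conj = ⊥
    rw [h2, Submodule.map_bot])
  let A : Fin 2 → Submodule ℂ V := ![(F.F 1).map r.conj, F.F 1]
  let H : HodgeStructure 1 V :=
    { real := r
      piece := A
      isInternal := isInternal_of_isCompl hc
      map_conj := by
        refine Fin.forall_fin_two.2 ⟨?_, rfl⟩
        change ((F.F 1).map r.conj).map r.conj = F.F 1
        ext x
        constructor
        · rintro ⟨_, ⟨w, hw, rfl⟩, rfl⟩
          rwa [r.conj_conj]
        · exact fun hx => ⟨_, ⟨x, hx, rfl⟩, r.conj_conj x⟩ }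
  refine ⟨H, rfl, CompleteFiltration.ext (funext fun j => ?_)⟩
  match j with
  | 0 => rw [H.filtration.zero_eq_top, F.zero_eq_top]
  | 1 => exact H.filtration_one
  | j + 2 =>
    rw [H.filtration_of_one_lt (by omega)]
    exact (eq_bot_iff.2 (h2 ▸ F.anti (by omega : 2 ≤ j + 2))).symm

end Surjectivity

end

theorem mainTheorem9 (V : Type*) [AddCommGroup V] [Module ℂ V] [FiniteDimensional ℂ V] :
    -- for a given decomposition of `V`: Hodge structures and quaternionic structures
    Set.BijOn (fun H : HodgeStructure 1 V => (H.piece, H.toQuaternionic)) Set.univ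
      {x | DirectSum.IsInternal x.1 ∧ ∀ r, (x.1 r).map x.2.J = x.1 r.rev} ∧
    -- every quaternionic structure on `V` comes from a Hodge structure
    (∀ Q : QuaternionicStructure V, ∃ H : HodgeStructure 1 V, H.toQuaternionic = Q) ∧
    -- for a given real structure of `V`: Hodge structures and semistable Rees–Simpson bundles
    Set.BijOn (fun H : HodgeStructure 1 V => (H.real, H.toBundle)) Set.univ
      {x | (∃ F : CompleteFiltration V, x.2 = reesSimpson F (F.conjBy x.1)) ∧
        x.2.IsSemistable 1} ∧
    -- the correspondences are compatible with isomorphism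
    ∀ H H' : HodgeStructure 1 V,
      (H.IsIso H' ↔ H.toQuaternionic.IsIso H'.toQuaternionic) ∧
      (H.IsIso H' ↔ H.toBundle.IsIso H'.toBundle) := by
  refine ⟨⟨fun H _ => ⟨H.isInternal, H.map_toJ⟩, fun H _ H' _ h => ?_, ?_⟩,
    fun Q => Q.exists_toQuaternionic_eq,
    ⟨fun H _ => ⟨⟨H.filtration, rfl⟩, H.isSemistable_toBundle⟩, fun H _ H' _ h => ?_, ?_⟩,
    fun H H' => ⟨⟨fun h => h.toQuaternionic, fun _ => H.isIso H'⟩,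
      ⟨fun h => h.toBundle, fun _ => H.isIso H'⟩⟩⟩
  · exact HodgeStructure.ext_of_toQuaternionic (congrArg Prod.fst h) (congrArg Prod.snd h)
  · rintro ⟨A, Q⟩ ⟨hA, hJ⟩
    exact ⟨Q.toHodge hA hJ, trivial, Prod.ext rfl (Q.toQuaternionic_toHodge hA hJ)⟩
  · exact HodgeStructure.ext_of_toBundle (congrArg Prod.fst h) (congrArg Prod.snd h)
  · rintro ⟨r, E⟩ ⟨⟨F, hF⟩, hE⟩
    obtain rfl : E = reesSimpson F (F.conjBy r) := hF
    obtain ⟨H, rfl, rfl⟩ := exists_hodgeStructure_of_isSemistable r F hE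
    exact ⟨H, trivial, rfl⟩
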